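/- Let $(X,\mathcal L,\lambda)$ be a measure space, where $\lambda$ is a non-negative, complete, countably additive measure on the $\sigma$-algebra $\mathcal L$, and let $L_\infty(X,\mathcal L,\lambda)$ be the Banach space of ($\lambda$-a.e. equivalence classes of) real-valued essentially bounded measurable functions on $X$ with the essential supremum norm. Write $u_k\rightharpoonup u_0$ in $L_\infty(X,\mathcal L,\lambda)$ if $f(u_k)\to f(u_0)$ as $k\to\infty$ for every bounded linear functional $f$ on $L_\infty(X,\mathcal L,\lambda)$. Let $N\in\mathbb N$. Suppose that $u_k^n\rightharpoonup u_0^n$ in $L_\infty(X,\mathcal L,\lambda)$ as $k\to\infty$ for each $n\in\{1,\dots,N\}$, and that $F:\mathbb R^N\to\mathbb R$ is continuous. Then $$F(u_k^1,\dots,u_k^N)\rightharpoonup F(u_0^1,\dots,u_0^N)\quad\text{in } L_\infty(X,\mathcal L,\lambda)\ \text{ as } k\to\infty,$$ where $F(v^1,\dots,v^N)\in L_\infty(X,\mathcal L,\lambda)$ denotes the class of $x\mapsto F(v^1(x),\dots,v^N(x))$. -/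

import Mathlib

open MeasureTheory Filter Topology
open scoped ENNReal

/-- Weak convergence `u k ⇀ v` of a sequence in a real normed space: `f (u k) → f v` for every
bounded linear functional `f`. -/
def WeaklyConverges {E : Type*} [NormedAddCommGroup E] [NormedSpace ℝ E] (u : ℕ → E) (v : E) :
    Prop :=
  ∀ f : StrongDual ℝ E, Tendsto (fun k => f (u k)) atTop (𝓝 (f v))

/-- `WeaklyConverges` is convergence in Mathlib's weak topology. -/
theorem weaklyConverges_iff_tendsto_toWeakSpace {E : Type*} [NormedAddCommGroup E]
    [NormedSpace ℝ E] (u : ℕ → E) (v : E) :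
    WeaklyConverges u v ↔
      Tendsto (fun k => toWeakSpace ℝ E (u k)) atTop (𝓝 (toWeakSpace ℝ E v)) := by
  have hind : IsInducing (fun (x : WeakSpace ℝ E) (y : StrongDual ℝ E) =>
      (topDualPairing ℝ E).flip x y) := ⟨rfl⟩
  rw [hind.tendsto_nhds_iff, tendsto_pi_nhds]
  rfl

/-- A continuous function of finitely many essentially bounded functions is essentially bounded. -/
theorem memLp_top_continuous_comp {X : Type*} [MeasurableSpace X] {μ : Measure X} {N : ℕ}
    {F : (Fin N → ℝ) → ℝ} (hF : Continuous F) (u : Fin N → Lp ℝ ∞ μ) :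
    MemLp (fun x => F (fun n => u n x)) ∞ μ := by
  obtain ⟨C, hC⟩ := (isCompact_univ_pi fun n => isCompact_closedBall (0 : ℝ) ‖u n‖)
    |>.exists_bound_of_continuousOn hF.continuousOn
  refine memLp_top_of_bound (hF.comp_aestronglyMeasurable (f := fun x n => u n x) ?_) C ?_
  · exact (aemeasurable_pi_lambda _ fun n =>
      (Lp.aestronglyMeasurable (u n)).aemeasurable).aestronglyMeasurable
  · have h : ∀ᵐ x ∂μ, ∀ n, ‖u n x‖ ≤ ‖u n‖ := by
      rw [ae_all_iff]
      intro n
      filter_upwards [enorm_ae_le_eLpNormEssSup (u n) μ] with x hx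
      rw [← eLpNorm_exponent_top, ← Lp.enorm_def] at hx
      exact enorm_le_iff_norm_le.1 hx
    filter_upwards [h] with x hx
    exact hC _ fun n _ => by simpa using hx n

/-- The class `F(u¹, …, uᴺ)` in `L_∞(μ)` of `x ↦ F (u¹ x, …, uᴺ x)`. -/
noncomputable def linftyComp {X : Type*} [MeasurableSpace X] {μ : Measure X} {N : ℕ}
    (F : (Fin N → ℝ) → ℝ) (hF : Continuous F) (u : Fin N → Lp ℝ ∞ μ) : Lp ℝ ∞ μ :=
  (memLp_top_continuous_comp hF u).toLp (fun x => F (fun n => u n x))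

/-- The class `F(u¹, …, uᴺ)` may be computed with any representatives of the `uⁿ`. -/
theorem linftyComp_ae_eq {X : Type*} [MeasurableSpace X] {μ : Measure X} {N : ℕ}
    (F : (Fin N → ℝ) → ℝ) (hF : Continuous F) (u : Fin N → Lp ℝ ∞ μ) (w : Fin N → X → ℝ)
    (hw : ∀ n, u n =ᵐ[μ] w n) :
    linftyComp F hF u =ᵐ[μ] fun x => F (fun n => w n x) := by
  have h : ∀ᵐ x ∂μ, ∀ n, u n x = w n x := ae_all_iff.2 hw
  filter_upwards [(memLp_top_continuous_comp hF u).coeFn_toLp, h] with x h1 h2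
  rw [linftyComp, h1]
  simp only [h2]

/-! If a bounded functional `φ` commutes with `F`, continuity gives `φ (F(u_k)) = F (φ u_k) → F (φ
u₀) = φ (F(u₀))`. Limits along ultrafilters finer than `ae μ` are such functionals, and there are
enough of them to compute the norm. Hence `L_∞` embeds isometrically in `C(K)`, where `K` is the
weak-* compact set of functionals of norm at most one commuting with `F`. The images of `F(u_k)` are
bounded and converge pointwise on `K`, hence weakly in `C(K)`: by Riesz every functional is
dominated by a finite measure, and dominated convergence applies. Hahn–Banach carries weak
convergence back to `L_∞`. -/

open scoped Pointwise NNReal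
open CompactlySupported

section CompactSpaceDual

variable {K : Type*} [TopologicalSpace K]

/-- The values of a functional on the continuous functions dominated by `g`. -/
def dominatedValues (L : StrongDual ℝ C(K, ℝ)) (g : K → ℝ) : Set ℝ :=
  {r | ∃ h : C(K, ℝ), (∀ x, |h x| ≤ g x) ∧ L h = r}

theorem dominatedValues_bddAbove [CompactSpace K] (L : StrongDual ℝ C(K, ℝ)) (g : C_c(K, ℝ≥0)) :
    BddAbove (dominatedValues L fun x => g x) := by
  obtain ⟨C, hC⟩ := isCompact_univ.exists_bound_of_continuousOn
    (f := fun x => (g x : ℝ)) (by fun_prop)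
  -- If `K` is empty, `C` may be negative.
  refine ⟨‖L‖ * max C 0, ?_⟩
  rintro _ ⟨h, hh, rfl⟩
  refine (Real.le_norm_self _).trans (L.le_of_opNorm_le_of_le le_rfl ?_)
  refine (ContinuousMap.norm_le _ (le_max_right _ _)).2 fun x => ?_
  exact (hh x).trans (((Real.le_norm_self _).trans (hC x trivial)).trans (le_max_left _ _))

theorem zero_mem_dominatedValues (L : StrongDual ℝ C(K, ℝ)) (g : C_c(K, ℝ≥0)) :
    0 ∈ dominatedValues L fun x => g x :=
  ⟨0, by simp, by simp⟩

theorem dominatedValues_add (L : StrongDual ℝ C(K, ℝ)) (g₁ g₂ : C_c(K, ℝ≥0)) :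
    dominatedValues L (fun x => ((g₁ + g₂) x : ℝ≥0)) =
      dominatedValues L (fun x => g₁ x) + dominatedValues L fun x => g₂ x := by
  ext r
  simp only [Set.mem_add]
  constructor
  · rintro ⟨h, hh, rfl⟩
    -- Truncating `h` to `[-g₁, g₁]` leaves a remainder bounded by `g₂`, because `|h| ≤ g₁ + g₂`.
    let h₁ : C(K, ℝ) := ⟨fun x => max (-(g₁ x : ℝ)) (min (h x) (g₁ x)), by fun_prop⟩
    have e : ∀ x, h₁ x = max (-(g₁ x : ℝ)) (min (h x) (g₁ x)) := fun _ => rfl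
    refine ⟨L h₁, ⟨h₁, fun x => ?_, rfl⟩, L (h - h₁), ⟨h - h₁, fun x => ?_, rfl⟩, by simp⟩
    · have := (g₁ x).coe_nonneg
      rw [e]
      grind
    · have h1 := (g₁ x).coe_nonneg
      have h2 := (g₂ x).coe_nonneg
      have h3 := hh x
      simp only [CompactlySupportedContinuousMap.coe_add, Pi.add_apply, NNReal.coe_add] at h3
      rw [ContinuousMap.sub_apply, e]
      grind
  · rintro ⟨_, ⟨h₁, hh₁, rfl⟩, _, ⟨h₂, hh₂, rfl⟩, rfl⟩
    refine ⟨h₁ + h₂, fun x => ?_, by simp⟩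
    simpa using (abs_add_le _ _).trans (add_le_add (hh₁ x) (hh₂ x))

theorem dominatedValues_smul (L : StrongDual ℝ C(K, ℝ)) (c : ℝ≥0) (g : C_c(K, ℝ≥0)) :
    dominatedValues L (fun x => ((c • g) x : ℝ≥0)) =
      (c : ℝ) • dominatedValues L fun x => g x := by
  ext r
  simp only [Set.mem_smul_set]
  constructor
  · rintro ⟨h, hh, rfl⟩
    rcases eq_or_ne c 0 with rfl | hc
    · refine ⟨0, zero_mem_dominatedValues L g, ?_⟩
      have : h = 0 := by
        ext x
        simpa using hh x
      simp [this]
    · have hc' : (0 : ℝ) < c := by positivity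
      refine ⟨L ((c : ℝ)⁻¹ • h), ⟨(c : ℝ)⁻¹ • h, fun x => ?_, rfl⟩, ?_⟩
      · have := hh x
        simp only [CompactlySupportedContinuousMap.coe_smul, Pi.smul_apply, smul_eq_mul,
          NNReal.coe_mul] at this
        rw [ContinuousMap.smul_apply, smul_eq_mul, abs_mul, abs_of_pos (inv_pos.2 hc'),
          inv_mul_le_iff₀ hc']
        exact this
      · rw [map_smul, smul_smul, mul_inv_cancel₀ hc'.ne', one_smul]
  · rintro ⟨_, ⟨h, hh, rfl⟩, rfl⟩
    refine ⟨(c : ℝ) • h, fun x => ?_, by simp⟩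
    simpa [abs_mul] using mul_le_mul_of_nonneg_left (hh x) c.coe_nonneg

/-- The total variation of a bounded functional on `C(K, ℝ)`, as a positive functional. -/
noncomputable def dualVariation [CompactSpace K] (L : StrongDual ℝ C(K, ℝ)) : C_c(K, ℝ≥0) →ₗ[ℝ≥0] ℝ≥0 where
  toFun g := ⟨sSup (dominatedValues L fun x => g x),
    le_csSup (dominatedValues_bddAbove L g) (zero_mem_dominatedValues L g)⟩
  map_add' g₁ g₂ := by
    refine NNReal.eq ?_
    change sSup (dominatedValues L fun x => ((g₁ + g₂) x : ℝ≥0)) =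
      sSup (dominatedValues L fun x => g₁ x) + sSup (dominatedValues L fun x => g₂ x)
    rw [dominatedValues_add, csSup_add ⟨0, zero_mem_dominatedValues L g₁⟩
      (dominatedValues_bddAbove L g₁) ⟨0, zero_mem_dominatedValues L g₂⟩
      (dominatedValues_bddAbove L g₂)]
  map_smul' c g := by
    refine NNReal.eq ?_
    change sSup (dominatedValues L fun x => ((c • g) x : ℝ≥0)) =
      c * sSup (dominatedValues L fun x => g x)
    rw [dominatedValues_smul, Real.sSup_smul_of_nonneg c.coe_nonneg, smul_eq_mul]

/-- A bounded functional on `C(K, ℝ)` is dominated by integration against a finite measure. -/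
theorem exists_finite_measure_abs_apply_le [CompactSpace K] [T2Space K] [MeasurableSpace K] [BorelSpace K]
    (L : StrongDual ℝ C(K, ℝ)) :
    ∃ ν : Measure K, IsFiniteMeasure ν ∧ ∀ h : C(K, ℝ), |L h| ≤ ∫ x, |h x| ∂ν := by
  have : (NNRealRMK.rieszMeasure (dualVariation L)).Regular := inferInstance
  refine ⟨NNRealRMK.rieszMeasure (dualVariation L), inferInstance, fun h => ?_⟩
  let g : C_c(K, ℝ≥0) := ⟨⟨fun x => ‖h x‖₊, by fun_prop⟩, HasCompactSupport.of_compactSpace _⟩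
  have hg : ∀ x, (g x : ℝ) = |h x| := fun x => rfl
  -- Used with `h' = h` and `h' = -h`, to bound both signs of `L h`.
  have key : ∀ h' : C(K, ℝ), (∀ x, |h' x| = |h x|) → L h' ≤ ∫ x, |h x| ∂(
      NNRealRMK.rieszMeasure (dualVariation L)) := by
    intro h' hh'
    simp_rw [← hg]
    rw [NNRealRMK.integral_rieszMeasure]
    exact le_csSup (dominatedValues_bddAbove L g) ⟨h', fun x => (hh' x).le, rfl⟩
  refine abs_le'.2 ⟨key h fun _ => rfl, ?_⟩
  rw [← map_neg]
  exact key (-h) fun x => by simp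

/-- Bounded pointwise convergence implies weak convergence in `C(K, ℝ)`. -/
theorem weaklyConverges_of_tendsto_apply [CompactSpace K] [T2Space K] {g : ℕ → C(K, ℝ)} {g₀ : C(K, ℝ)} {C : ℝ}
    (hC : ∀ k x, |g k x| ≤ C) (hg : ∀ x, Tendsto (fun k => g k x) atTop (𝓝 (g₀ x))) :
    WeaklyConverges g g₀ := by
  intro L
  borelize K
  obtain ⟨ν, hν, hL⟩ := exists_finite_measure_abs_apply_le L
  have hlim : Tendsto (fun k => ∫ x, |(g k - g₀) x| ∂ν) atTop (𝓝 (∫ _, (0 : ℝ) ∂ν)) := by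
    refine tendsto_integral_of_dominated_convergence (fun _ => C + ‖g₀‖)
      (fun k => (by fun_prop : Continuous fun x => |(g k - g₀) x|).aestronglyMeasurable)
      (integrable_const _) (fun k => ae_of_all _ fun x => ?_) (ae_of_all _ fun x => ?_)
    · rw [Real.norm_eq_abs, abs_abs, ContinuousMap.sub_apply]
      exact (abs_sub _ _).trans (add_le_add (hC k x) (g₀.norm_coe_le_norm x))
    · simpa using ((hg x).sub_const (g₀ x)).abs
  rw [integral_zero] at hlim
  rw [tendsto_iff_norm_sub_tendsto_zero]
  refine squeeze_zero (fun _ => norm_nonneg _) (fun k => ?_) hlim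
  rw [← map_sub]
  exact hL _

end CompactSpaceDual

/-- Uniform boundedness principle in the bidual: each scalar sequence `f (u k)` converges, so it is
bounded. -/
theorem WeaklyConverges.exists_norm_le {E : Type*} [NormedAddCommGroup E] [NormedSpace ℝ E]
    {u : ℕ → E} {v : E} (h : WeaklyConverges u v) : ∃ C, ∀ k, ‖u k‖ ≤ C := by
  obtain ⟨C, hC⟩ := banach_steinhaus
    (g := fun k => NormedSpace.inclusionInDoubleDualLi ℝ (E := E) (u k)) fun f => by
      obtain ⟨C, hC⟩ := (h f).norm.bddAbove_range
      exact ⟨C, fun k => hC ⟨k, rfl⟩⟩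
  exact ⟨C, fun k => (LinearIsometry.norm_map _ _).symm.trans_le (hC k)⟩

theorem ae_norm_le_norm_linfty {X : Type*} [MeasurableSpace X] {μ : Measure X} (u : Lp ℝ ∞ μ) :
    ∀ᵐ x ∂μ, ‖u x‖ ≤ ‖u‖ := by
  filter_upwards [enorm_ae_le_eLpNormEssSup u μ] with x hx
  rw [← eLpNorm_exponent_top, ← Lp.enorm_def] at hx
  exact enorm_le_iff_norm_le.1 hx

theorem exists_norm_linftyComp_le {X : Type*} [MeasurableSpace X] {μ : Measure X} {N : ℕ}
    (F : (Fin N → ℝ) → ℝ) (hF : Continuous F) (R : Fin N → ℝ) :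
    ∃ C, ∀ u : Fin N → Lp ℝ ∞ μ, (∀ n, ‖u n‖ ≤ R n) → ‖linftyComp F hF u‖ ≤ C := by
  obtain ⟨C, hC⟩ := (isCompact_univ_pi fun n => isCompact_closedBall (0 : ℝ) (R n))
    |>.exists_bound_of_continuousOn hF.continuousOn
  refine ⟨max C 0, fun u hu => ?_⟩
  have hb : ∀ᵐ x ∂μ, ‖linftyComp F hF u x‖ ≤ max C 0 := by
    filter_upwards [linftyComp_ae_eq F hF u (fun n => u n) fun n => ae_eq_rfl,
      ae_all_iff.2 fun n => ae_norm_le_norm_linfty (u n)] with x h1 h2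
    rw [h1]
    exact (hC _ fun n _ => by simpa using (h2 n).trans (hu n)).trans (le_max_left _ _)
  rw [Lp.norm_def]
  refine ENNReal.toReal_le_of_le_ofReal (le_max_right _ _) ?_
  simpa using eLpNorm_le_of_ae_bound (p := ∞) hb

section Ultrafilter

variable {X : Type*} [MeasurableSpace X] {μ : Measure X}

theorem exists_tendsto_of_ultrafilter_le_ae {l : Ultrafilter X} (hl : (l : Filter X) ≤ ae μ)
    (u : Lp ℝ ∞ μ) : ∃ a, |a| ≤ ‖u‖ ∧ Tendsto u l (𝓝 a) := by
  obtain ⟨a, ha, h⟩ := (isCompact_closedBall (0 : ℝ) ‖u‖).ultrafilter_le_nhds (l.map u) (by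
    have h : ∀ᶠ x in (l : Filter X), ‖u x‖ ≤ ‖u‖ := hl (ae_norm_le_norm_linfty u)
    rw [le_principal_iff, Ultrafilter.coe_map, mem_map]
    filter_upwards [h] with x hx
    exact mem_closedBall_zero_iff.2 hx)
  exact ⟨a, by simpa using ha, h⟩

/-- The limit of essentially bounded functions along an ultrafilter avoiding the null sets. -/
theorem exists_dual_tendsto_of_ultrafilter_le_ae {l : Ultrafilter X}
    (hl : (l : Filter X) ≤ ae μ) :
    ∃ φ : StrongDual ℝ (Lp ℝ ∞ μ), ‖φ‖ ≤ 1 ∧ ∀ u : Lp ℝ ∞ μ, Tendsto u l (𝓝 (φ u)) := by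
  choose a ha hlim using fun u : Lp ℝ ∞ μ => exists_tendsto_of_ultrafilter_le_ae hl u
  let φ : Lp ℝ ∞ μ →ₗ[ℝ] ℝ :=
    { toFun := a
      map_add' := fun u v => tendsto_nhds_unique
        ((hlim (u + v)).congr' (hl (Lp.coeFn_add u v))) ((hlim u).add (hlim v))
      map_smul' := fun c u => tendsto_nhds_unique
        ((hlim (c • u)).congr' (hl (Lp.coeFn_smul c u))) ((hlim u).const_smul c) }
  have hφ : ∀ u, ‖φ u‖ ≤ 1 * ‖u‖ := fun u => (ha u).trans_eq (one_mul _).symm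
  exact ⟨φ.mkContinuous 1 hφ, φ.mkContinuous_norm_le zero_le_one hφ, hlim⟩

/-- The functionals of norm at most one that commute with `F`. -/
def evalFunctionals (μ : Measure X) {N : ℕ} (F : (Fin N → ℝ) → ℝ) (hF : Continuous F) :
    Set (WeakDual ℝ (Lp ℝ ∞ μ)) :=
  (WeakDual.toStrongDual ⁻¹' Metric.closedBall 0 1) ∩
    {φ | ∀ u : Fin N → Lp ℝ ∞ μ, φ (linftyComp F hF u) = F fun n => φ (u n)}

/-- Banach–Alaoglu: since `F` is continuous, commuting with it is a weak-* closed condition. -/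
theorem isCompact_evalFunctionals {N : ℕ} (F : (Fin N → ℝ) → ℝ) (hF : Continuous F) :
    IsCompact (evalFunctionals μ F hF) := by
  refine (WeakDual.isCompact_closedBall 0 1).inter_right ?_
  rw [Set.ofPred_forall]
  exact isClosed_iInter fun u => isClosed_eq (WeakDual.eval_continuous _)
    (hF.comp (continuous_pi fun n => WeakDual.eval_continuous _))

/-- The set where `|u| > c` is not null, so some ultrafilter finer than `ae μ` contains it; the
limit along that ultrafilter is the functional. -/
theorem exists_mem_evalFunctionals_le_abs {N : ℕ} (F : (Fin N → ℝ) → ℝ) (hF : Continuous F)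
    (u : Lp ℝ ∞ μ) {c : ℝ} (hc : 0 ≤ c) (hcu : c < ‖u‖) :
    ∃ φ ∈ evalFunctionals μ F hF, c ≤ |φ u| := by
  have hne : (ae μ ⊓ 𝓟 {x | c < |u x|}).NeBot := by
    rw [← frequently_mem_iff_neBot]
    intro h
    refine hcu.not_ge ?_
    rw [Lp.norm_def]
    refine ENNReal.toReal_le_of_le_ofReal hc ?_
    have hb : ∀ᵐ x ∂μ, ‖u x‖ ≤ c := by
      filter_upwards [h] with x hx
      simpa using hx
    simpa using eLpNorm_le_of_ae_bound (p := ∞) hb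
  obtain ⟨l, hl⟩ := Ultrafilter.exists_le (ae μ ⊓ 𝓟 {x | c < |u x|})
  obtain ⟨hl, hlu⟩ := le_inf_iff.1 hl
  obtain ⟨φ, hφ, hlim⟩ := exists_dual_tendsto_of_ultrafilter_le_ae hl
  refine ⟨StrongDual.toWeakDual φ, ⟨by simpa using hφ, fun v => ?_⟩, ?_⟩
  · have h1 := (hlim (linftyComp F hF v)).congr'
      (hl (linftyComp_ae_eq F hF v (fun n => v n) fun n => ae_eq_rfl))
    exact tendsto_nhds_unique h1
      ((hF.tendsto _).comp (tendsto_pi_nhds.2 fun n => hlim (v n)))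
  · refine ge_of_tendsto (hlim u).abs ?_
    filter_upwards [le_principal_iff.1 hlu] with x hx using le_of_lt hx

/-- The isometric evaluation of `L_∞(μ)` on the functionals commuting with `F`. -/
noncomputable def evalLI {N : ℕ} (F : (Fin N → ℝ) → ℝ) (hF : Continuous F)
    [CompactSpace (evalFunctionals μ F hF)] :
    Lp ℝ ∞ μ →ₗᵢ[ℝ] C(evalFunctionals μ F hF, ℝ) where
  toFun u := ⟨fun φ => φ.1 u, (WeakDual.eval_continuous u).comp continuous_subtype_val⟩
  map_add' u v := by ext φ; exact map_add φ.1 u v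
  map_smul' c u := by ext φ; exact map_smul φ.1 c u
  norm_map' u := by
    refine le_antisymm ((ContinuousMap.norm_le _ (norm_nonneg u)).2 fun φ => ?_) ?_
    · have h : ‖WeakDual.toStrongDual φ.1‖ ≤ 1 := by simpa using φ.2.1
      simpa using (WeakDual.toStrongDual φ.1).le_of_opNorm_le h u
    · by_contra! hlt
      obtain ⟨c, hc, hcu⟩ := exists_between hlt
      obtain ⟨φ, hφ, hle⟩ := exists_mem_evalFunctionals_le_abs F hF u
        ((norm_nonneg _).trans hc.le) hcu
      refine (hc.trans_le hle).not_ge ?_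
      exact ContinuousMap.norm_coe_le_norm
        (⟨fun φ => φ.1 u, (WeakDual.eval_continuous u).comp continuous_subtype_val⟩ :
          C(evalFunctionals μ F hF, ℝ)) ⟨φ, hφ⟩

theorem evalLI_apply {N : ℕ} (F : (Fin N → ℝ) → ℝ) (hF : Continuous F)
    [CompactSpace (evalFunctionals μ F hF)] (u : Lp ℝ ∞ μ) (φ : evalFunctionals μ F hF) :
    evalLI F hF u φ = φ.1 u :=
  rfl

end Ultrafilter

/-- Weak convergence may be tested after an isometric embedding. -/
theorem WeaklyConverges.of_linearIsometry {E G : Type*} [NormedAddCommGroup E] [NormedSpace ℝ E]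
    [NormedAddCommGroup G] [NormedSpace ℝ G] (T : E →ₗᵢ[ℝ] G) {u : ℕ → E} {v : E}
    (h : WeaklyConverges (fun k => T (u k)) (T v)) : WeaklyConverges u v := by
  intro f
  -- Hahn–Banach: `f`, transported to the range of `T`, extends to all of `G`.
  obtain ⟨g, hg, -⟩ := exists_extension_norm_eq (LinearMap.range T.toLinearMap)
    (f.comp (T.equivRange.symm.toContinuousLinearEquiv : _ →L[ℝ] E))
  have key : ∀ w, g (T w) = f w := fun w => by
    have := hg (T.equivRange w)
    simpa using this
  simpa [key] using h g

theorem theorem2p10 {X : Type*} [MeasurableSpace X] (μ : Measure X) [μ.IsComplete] (N : ℕ)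
    (u : ℕ → Fin N → Lp ℝ ∞ μ) (u₀ : Fin N → Lp ℝ ∞ μ)
    (hu : ∀ n : Fin N, WeaklyConverges (fun k => u k n) (u₀ n))
    (F : (Fin N → ℝ) → ℝ) (hF : Continuous F) :
    WeaklyConverges (fun k => linftyComp F hF (u k)) (linftyComp F hF u₀) := by
  have : CompactSpace (evalFunctionals μ F hF) :=
    isCompact_iff_compactSpace.1 (isCompact_evalFunctionals F hF)
  choose R hR using fun n => (hu n).exists_norm_le
  obtain ⟨C, hC⟩ := exists_norm_linftyComp_le (μ := μ) F hF R
  refine .of_linearIsometry (evalLI F hF) (weaklyConverges_of_tendsto_apply (C := C)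
    (fun k φ => ?_) fun φ => ?_)
  · refine (ContinuousMap.norm_coe_le_norm (evalLI F hF (linftyComp F hF (u k))) φ).trans ?_
    rw [LinearIsometry.norm_map]
    exact hC _ fun n => hR n k
  · simp only [evalLI_apply]
    rw [φ.2.2 u₀]
    simp_rw [fun k => φ.2.2 (u k)]
    exact (hF.tendsto _).comp (tendsto_pi_nhds.2 fun n => hu n (WeakDual.toStrongDual φ.1))
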